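/- Let $n$ be a positive integer and let $\mathcal{P}ol=\mathbb Z[\tfrac12][x_1,\dots,x_n]$. For $1\le i\le n-1$ let $s_i$ act on $\mathcal{P}ol$ by exchanging $x_i$ and $x_{i+1}$, and let $s_0$ act by $x_1\mapsto -x_1$, fixing the other variables. Define the divided differences $$f\,\partial_0=\frac{f-f^{s_0}}{-x_1},\qquad f\,\partial_i=\frac{f-f^{s_i}}{x_i-x_{i+1}}\quad(1\le i\le n-1).$$ Operators act on their left, and polynomials act by multiplication, so in $f\,\partial_0\partial_1\cdots\partial_{n-1}$ the operator $\partial_0$ is applied first. Let $e_i$ be the $i$-th elementary symmetric polynomial in $x_1,\dots,x_n$ (with $e_0=1$ and $e_i=0$ for $i>n$). For integers $i\ge j\ge 0$ put $$\widetilde Q_{i,j}=e_ie_j+2\sum_{p=1}^{j}(-1)^p e_{i+p}e_{j-p}.$$ For a partition $I=(i_1\ge\dots\ge i_k)$, where $k$ is even (a zero is appended to the nonzero parts if their number is odd), let $\widetilde Q_I$ be the Pfaffian of the $k\times k$ skew-symmetric matrix with entries $\widetilde Q_{i_p,i_q}$ for $1\le p<q\le k$. Let $\ell(I)$ be the number of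 nonzero parts of $I$, call $I$ strict if its nonzero parts are distinct, and let $\rho(n)=(n,n-1,\dots,1)$; $I\subseteq\rho(n)$ means componentwise $\le$. Then for every strict partition $I\subseteq\rho(n)$, $$\widetilde Q_I\,x_1^n\,\partial_0\partial_1\cdots\partial_{n-1}=\begin{cases}-2\,\widetilde Q_I, & n+\ell(I)\ \text{odd},\\ 0, & n+\ell(I)\ \text{even}.\end{cases}$$ -/

import Mathlib

open MvPolynomial

noncomputable section

/-! Strict partitions.  A partition is given by the list of its (nonzero) parts. -/

/-- `I = (i₁ > i₂ > ⋯ > i_ℓ > 0)`: the list of parts of a strict partition; its length `ℓ(I)` is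
`I.length`. -/
def IsStrictPartition (I : List ℕ) : Prop :=
  I.Pairwise (fun a b => a > b) ∧ ∀ i ∈ I, 0 < i

/-- Containment `I ⊆ J` of partitions: componentwise comparison, after adding zeros at the end. -/
def PartitionLE (I J : List ℕ) : Prop :=
  ∀ p : ℕ, I.getD p 0 ≤ J.getD p 0

/-- The partition `ρ(n) = (n, n - 1, …, 1)`. -/
def staircase (n : ℕ) : List ℕ := (List.range' 1 n).reverse

/-! Divided differences of type B.  The variables `x₁, …, xₙ` are `X 0, …, X (n - 1)`, indexed by
`Fin n`; the generators `s₀, …, sₙ₋₁` are indexed by `Fin n` too. -/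

/-- The index of the variable `xᵢ`, for `1 ≤ i < n` (so that `i` itself is the index of
`xᵢ₊₁`). -/
def predIndex {n : ℕ} (i : Fin n) : Fin n := ⟨i.val - 1, by omega⟩

/-- The action `f ↦ f ^ sᵢ` on polynomials: `s₀` sends `x₁` to `-x₁` and fixes the other variables;
for `1 ≤ i < n`, `sᵢ` exchanges `xᵢ` and `xᵢ₊₁`. -/
def simpleReflection {n : ℕ} (R : Type*) [CommRing R] (i : Fin n) :
    MvPolynomial (Fin n) R →ₐ[R] MvPolynomial (Fin n) R :=
  if i.val = 0 then aeval (fun j => if j = i then -X j else X j)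
  else rename (Equiv.swap (predIndex i) i)

/-- The denominators of the divided differences: `-x₁` for `i = 0` and `xᵢ - xᵢ₊₁` for
`1 ≤ i < n`. -/
def simpleDenom {n : ℕ} (R : Type*) [CommRing R] (i : Fin n) : MvPolynomial (Fin n) R :=
  if i.val = 0 then -X i else X (predIndex i) - X i

theorem simpleDenom_dvd {n : ℕ} {R : Type*} [CommRing R] (i : Fin n)
    (f : MvPolynomial (Fin n) R) : simpleDenom R i ∣ f - simpleReflection R i f := by
  induction f using MvPolynomial.induction_on with
  | C a => simp [← MvPolynomial.algebraMap_eq]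
  | add p q hp hq =>
    have h : p + q - simpleReflection R i (p + q)
        = (p - simpleReflection R i p) + (q - simpleReflection R i q) := by
      rw [map_add]; ring
    rw [h]
    exact dvd_add hp hq
  | mul_X p j hp =>
    have hX : simpleDenom R i ∣ X j - simpleReflection R i (X j) := by
      unfold simpleDenom simpleReflection
      split_ifs with h0
      · rw [aeval_X]
        split_ifs with hj
        · subst hj
          exact ⟨-2, by ring⟩
        · simp
      · rw [rename_X]
        by_cases h1 : j = predIndex i
        · subst h1
          simp
        · by_cases h2 : j = i
          · subst h2
            rw [Equiv.swap_apply_right]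
            exact ⟨-1, by ring⟩
          · rw [Equiv.swap_apply_of_ne_of_ne h1 h2]
            simp
    have h : p * X j - simpleReflection R i (p * X j)
        = (p - simpleReflection R i p) * X j
          + simpleReflection R i p * (X j - simpleReflection R i (X j)) := by
      rw [map_mul]; ring
    rw [h]
    exact dvd_add (Dvd.dvd.mul_right hp _) (Dvd.dvd.mul_left hX _)

/-- The simple divided difference `f ∂ᵢ = (f - f ^ sᵢ) / dᵢ`, where `d₀ = -x₁` and
`dᵢ = xᵢ - xᵢ₊₁` for `1 ≤ i < n`. -/
def divDiff {n : ℕ} {R : Type*} [CommRing R] (i : Fin n) (f : MvPolynomial (Fin n) R) :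
    MvPolynomial (Fin n) R :=
  (simpleDenom_dvd i f).choose

theorem divDiff_spec {n : ℕ} {R : Type*} [CommRing R] (i : Fin n)
    (f : MvPolynomial (Fin n) R) :
    f - simpleReflection R i f = simpleDenom R i * divDiff i f :=
  (simpleDenom_dvd i f).choose_spec

theorem divDiff_unique {n : ℕ} {R : Type*} [CommRing R] [IsDomain R] (i : Fin n)
    (f g : MvPolynomial (Fin n) R) (h : f - simpleReflection R i f = simpleDenom R i * g) :
    divDiff i f = g := by
  have hne : simpleDenom R i ≠ 0 := by
    unfold simpleDenom
    split_ifs with h0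
    · simp
    · refine sub_ne_zero.mpr fun hX => ?_
      have h1 := congrArg Fin.val (X_injective hX)
      simp only [predIndex] at h1
      omega
  exact mul_left_cancel₀ hne ((divDiff_spec i f).symm.trans h)

/-- `f ∂₀ ∂₁ ⋯ ∂ₙ₋₁`; operators act on their left, so `∂₀` is applied first and `∂ₙ₋₁` last. -/
def divDiffChain {n : ℕ} {R : Type*} [CommRing R] (f : MvPolynomial (Fin n) R) :
    MvPolynomial (Fin n) R :=
  (List.finRange n).foldl (fun g i => divDiff i g) f

/-! The `Q̃`-polynomials. -/

/-- The Pfaffian of a skew-symmetric matrix, by expansion along the first row; it is `0` for a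
matrix of odd size and `1` for the empty matrix. -/
def pfaffian {S : Type*} [CommRing S] : (m : ℕ) → Matrix (Fin m) (Fin m) S → S
  | 0, _ => 1
  | 1, _ => 0
  | m + 2, A => ∑ j : Fin (m + 1), (-1) ^ (j : ℕ) * A 0 j.succ *
      pfaffian m (A.submatrix (fun a => (j.succAbove a).succ) (fun a => (j.succAbove a).succ))

/-- `Q̃_{i,j} = e_i e_j + 2 ∑_{p=1}^{j} (-1)^p e_{i+p} e_{j-p}`, for `i ≥ j`, where
`e_i = Q̃_i` is the `i`-th elementary symmetric polynomial in `x₁, …, xₙ`. -/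
def qTildePair (n : ℕ) (R : Type*) [CommRing R] (i j : ℕ) : MvPolynomial (Fin n) R :=
  esymm (Fin n) R i * esymm (Fin n) R j
    + 2 * ∑ p ∈ Finset.Icc 1 j, (-1) ^ p * (esymm (Fin n) R (i + p) * esymm (Fin n) R (j - p))

/-- The skew-symmetric matrix with entries `Q̃_{i_p, i_q}` for `p < q`. -/
def qTildeMatrix (n : ℕ) (R : Type*) [CommRing R] (L : List ℕ) :
    Matrix (Fin L.length) (Fin L.length) (MvPolynomial (Fin n) R) :=
  fun p q =>
    if p < q then qTildePair n R (L.get p) (L.get q)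
    else if q < p then -qTildePair n R (L.get q) (L.get p)
    else 0

/-- The representative of even length of a partition: a zero is added at the end if the number of
parts is odd. -/
def evenRepresentative (I : List ℕ) : List ℕ :=
  if Even I.length then I else I ++ [0]

/-- The polynomial `Q̃_I = Q̃_I(x₁, …, xₙ)`, as a Pfaffian. -/
def qTilde (n : ℕ) (R : Type*) [CommRing R] (I : List ℕ) : MvPolynomial (Fin n) R :=
  pfaffian (evenRepresentative I).length (qTildeMatrix n R (evenRepresentative I))

/-- The coefficient ring `ℤ[1/2]`. -/
abbrev ZHalf : Type := Localization.Away (2 : ℤ)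

end

open MvPolynomial

/-! Put $m=n-1$. Dividing by $-x_1$ gives $f x_1^n\partial_0=-x_1^m f+(-1)^n x_1^m f^{s_0}$. The
remaining chain $\partial_1\cdots\partial_m$ (`symChain`) is linear over symmetric polynomials and
sends $x_1^m$ to 1, so with $f=\widetilde Q_I$ everything reduces to the claim that $x_1^m\widetilde
Q_I^{s_0}$ goes to $(-1)^{\ell(I)}\widetilde Q_I$.

Write $e_i=h_i+t_i$, where $h_i$ collects the terms divisible by $x_1$. By telescoping, $s_0$ adds
to the matrix $(\widetilde Q_{i_p,i_q})$ the wedge of $(-2h_{i_p})$ and $(e_{i_p})$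
(`map_simpleReflection_zero_qTildeMatrix`). A Pfaffian perturbed by $a\wedge e$ is affine in $a$
(`exists_pfaffian_add_wedgeMatrix`), and here its coefficients are symmetric. Hence the chain merely
replaces $x_1^m h_i$ by its image, which is $e_i$ for $i>0$ and 0 for $i=0$. Without an appended
zero the new wedge is $-2e\wedge e=0$; with one, it flips the sign of the last row and column, hence
of the Pfaffian. -/

noncomputable section

/-! Pfaffians and contractions in the exterior algebra. -/

section Pfaffian

open CliffordAlgebra

variable {S : Type*} [CommRing S]

/-- Contraction of a product of vectors with a linear form. -/
theorem contractLeft_ιMulti {V : Type*} [AddCommGroup V] [Module S V] (d : Module.Dual S V)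
    (m : ℕ) (v : Fin (m + 1) → V) :
    contractLeft d (ExteriorAlgebra.ιMulti S (m + 1) v)
      = ∑ j : Fin (m + 1), ((-1) ^ (j : ℕ) * d (v j)) •
          ExteriorAlgebra.ιMulti S m (fun a => v (j.succAbove a)) := by
  induction m with
  | zero =>
    rw [ExteriorAlgebra.ιMulti_succ_apply]
    refine (contractLeft_ι_mul _ _ _).trans ?_
    simp
  | succ m ih =>
    rw [ExteriorAlgebra.ιMulti_succ_apply]
    refine (contractLeft_ι_mul _ _ _).trans ?_
    rw [ih, Finset.mul_sum, sub_eq_add_neg, ← Finset.sum_neg_distrib]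
    conv_rhs => rw [Fin.sum_univ_succ]
    congr 1
    · simp [Matrix.vecTail, Function.comp_def]
    · refine Finset.sum_congr rfl fun j _ => ?_
      rw [ExteriorAlgebra.ιMulti_succ_apply, mul_smul_comm, ← neg_smul]
      congr 1
      · simp [Matrix.vecTail, pow_succ]
      · simp [Matrix.vecTail, Function.comp_def]

/-- An alternating form does not alter the zero quadratic form, so `changeForm` maps the exterior
algebra to itself. -/
theorem toQuadraticMap_neg_eq_zero {V : Type*} [AddCommGroup V] [Module S V]
    {B : LinearMap.BilinForm S V} (hB : ∀ x, B x x = 0) :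
    (-B).toQuadraticMap = (0 : QuadraticForm S V) - 0 := by
  ext x
  simp [hB]

/-- The Pfaffian of the Gram matrix of an alternating form, as the scalar part of a product of
vectors after a change of form. -/
theorem pfaffian_gram {V : Type*} [AddCommGroup V] [Module S V]
    (B : LinearMap.BilinForm S V) (hB : ∀ x, B x x = 0) : ∀ (m : ℕ) (v : Fin m → V),
    pfaffian m (Matrix.of fun i j => B (v i) (v j))
      = ExteriorAlgebra.algebraMapInv
          (changeForm (toQuadraticMap_neg_eq_zero hB) (ExteriorAlgebra.ιMulti S m v))
  | 0, v => by
    rw [ExteriorAlgebra.ιMulti_zero_apply]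
    erw [changeForm_one]
    simp [pfaffian]
  | 1, v => by
    rw [ExteriorAlgebra.ιMulti_succ_apply, ExteriorAlgebra.ιMulti_zero_apply, mul_one]
    erw [changeForm_ι]
    simp only [pfaffian]
    exact (by simp [ExteriorAlgebra.algebraMapInv] :
      ExteriorAlgebra.algebraMapInv (ExteriorAlgebra.ι S (v 0)) = (0 : S)).symm
  | m + 2, v => by
    rw [ExteriorAlgebra.ιMulti_succ_apply]
    erw [changeForm_ι_mul]
    -- The term with the factor `v 0` has no scalar part; contraction with `B (v 0)` is the
    -- expansion along the first row. The form `-B` makes its sign positive.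
    rw [LinearMap.neg_apply, map_neg, LinearMap.neg_apply, sub_neg_eq_add, map_add, map_mul,
      ← changeForm_contractLeft]
    have h0 : ExteriorAlgebra.algebraMapInv (ExteriorAlgebra.ι S (v 0)) = (0 : S) := by
      simp [ExteriorAlgebra.algebraMapInv]
    erw [h0]
    rw [zero_mul, zero_add]
    erw [contractLeft_ιMulti]
    rw [map_sum, map_sum]
    simp only [pfaffian]
    refine Finset.sum_congr rfl fun j _ => ?_
    rw [map_smul, map_smul, smul_eq_mul]
    erw [← pfaffian_gram B hB m]
    rfl

/-- The change of form for `a ∧ e`, where `a` and `e` are linear forms. -/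
theorem changeForm_wedge {V : Type*} [AddCommGroup V] [Module S V]
    {B : LinearMap.BilinForm S V} (a e : Module.Dual S V)
    (hB : ∀ x y, B x y = a x * e y - e x * a y)
    (h : (-B).toQuadraticMap = (0 : QuadraticForm S V) - 0) (x : ExteriorAlgebra S V) :
    changeForm h x = x - contractLeft a (contractLeft e x) := by
  induction x using CliffordAlgebra.left_induction with
  | algebraMap r => rw [changeForm_algebraMap]; simp
  | add x y hx hy =>
    simp only [map_add, hx, hy]
    abel
  | ι_mul x m hx =>
    have hm : B m = a m • e - e m • a := by
      ext y
      simp [hB]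
    rw [changeForm_ι_mul, hx, LinearMap.neg_apply, hm]
    simp only [map_neg, map_sub, map_smul, LinearMap.sub_apply, LinearMap.smul_apply,
      LinearMap.neg_apply, contractLeft_ι_mul, contractLeft_contractLeft]
    -- Contractions anticommute and square to zero, so no term of higher order survives.
    rw [contractLeft_comm e a (contractLeft e x), contractLeft_contractLeft]
    simp only [map_zero, neg_zero, smul_zero, mul_sub]
    abel

theorem toBilin'_self_eq_zero {ι : Type*} [Fintype ι] [DecidableEq ι] (A : Matrix ι ι S)
    (hA : ∀ i j, A i j = -A j i) (hA0 : ∀ i, A i i = 0) (x : ι → S) :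
    Matrix.toBilin' A x x = 0 := by
  rw [Matrix.toBilin'_apply, ← Finset.sum_product']
  refine Finset.sum_involution (fun p _ => p.swap) ?_ ?_ (by simp) (by simp)
  · rintro ⟨i, j⟩ -
    simp only [Prod.fst_swap, Prod.snd_swap]
    rw [hA j i]
    ring
  · rintro ⟨i, j⟩ - hij h
    simp only [Prod.swap_prod_mk, Prod.mk.injEq] at h
    obtain ⟨rfl, -⟩ := h
    exact hij (by simp [hA0])

/-- The alternating matrix `a ∧ e`. -/
def wedgeMatrix {ι : Type*} (a e : ι → S) : Matrix ι ι S :=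
  Matrix.of fun i j => a i * e j - e i * a j

/-- The Pfaffian of `A + a ∧ e` depends on `a` in an affine way. -/
theorem exists_pfaffian_add_wedgeMatrix {m : ℕ} (A : Matrix (Fin m) (Fin m) S)
    (hA : ∀ i j, A i j = -A j i) (hA0 : ∀ i, A i i = 0) (e : Fin m → S) :
    ∃ φ : (Fin m → S) →ₗ[S] S, ∀ a,
      pfaffian m (A + wedgeMatrix a e) = pfaffian m A + φ a := by
  let b := Pi.basisFun S (Fin m)
  let D : (Fin m → S) ≃ₗ[S] Module.Dual S (Fin m → S) := b.constr S
  have hB := toBilin'_self_eq_zero A hA hA0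
  let x := ExteriorAlgebra.ιMulti S m b
  let ψ : (Fin m → S) →ₗ[S] S :=
    (ExteriorAlgebra.algebraMapInv (R := S) (M := Fin m → S)).toLinearMap ∘ₗ
      changeForm (toQuadraticMap_neg_eq_zero hB) ∘ₗ
      (contractLeft (Q := (0 : QuadraticForm S (Fin m → S)))).flip (contractLeft (D e) x) ∘ₗ
      D.toLinearMap
  refine ⟨-ψ, fun a => ?_⟩
  have hD : ∀ c i, D c (b i) = c i := fun c i => b.constr_basis S c i
  let B' : LinearMap.BilinForm S (Fin m → S) :=
    (LinearMap.mul S S).compl₁₂ (D a) (D e) - (LinearMap.mul S S).compl₁₂ (D e) (D a)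
  have hB'apply : ∀ x y, B' x y = D a x * D e y - D e x * D a y := fun x y => by simp [B']
  have hB' : ∀ x, B' x x = 0 := fun x => by rw [hB'apply]; ring
  have hsum : ∀ x, (Matrix.toBilin' A + B') x x = 0 := fun x => by
    rw [LinearMap.add_apply, LinearMap.add_apply, hB, hB', add_zero]
  have hAb : ∀ i j, Matrix.toBilin' A (b i) (b j) = A i j := fun i j => by
    simp [b]
  have h1 := pfaffian_gram _ hB m b
  have h2 := pfaffian_gram _ hsum m b
  have e1 : (Matrix.of fun i j => Matrix.toBilin' A (b i) (b j)) = A := by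
    ext i j; exact hAb i j
  have e2 : (Matrix.of fun i j => (Matrix.toBilin' A + B') (b i) (b j))
      = A + wedgeMatrix a e := by
    ext i j
    simp only [Matrix.of_apply, LinearMap.add_apply, hAb, hB'apply, hD, Matrix.add_apply,
      wedgeMatrix]
  rw [e1] at h1
  rw [e2] at h2
  -- Changes of form compose by adding the forms: the wedge acts first, as $1-\iota_a\iota_e$, and
  -- `A` second. Only $\iota_a$ involves `a`, linearly.
  have h3 := changeForm_changeForm (toQuadraticMap_neg_eq_zero hB')
    (toQuadraticMap_neg_eq_zero hB) x
  rw [changeForm_wedge (D a) (D e) hB'apply] at h3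
  rw [h1, h2]
  have h4 : ∀ (C : LinearMap.BilinForm S (Fin m → S)) (_ : C = -B' + -Matrix.toBilin' A)
      (hC : C.toQuadraticMap = (0 : QuadraticForm S (Fin m → S)) - 0),
      changeForm hC x = changeForm (toQuadraticMap_neg_eq_zero hB)
        (x - contractLeft (D a) (contractLeft (D e) x)) := by
    rintro C rfl hC
    exact h3.symm
  rw [h4 _ (by abel) _, map_sub, map_sub, sub_eq_add_neg]
  rfl

/-- The Pfaffian of `(dᵢ dⱼ Aᵢⱼ)`. -/
theorem pfaffian_scale : ∀ (m : ℕ) (d : Fin m → S) (A : Matrix (Fin m) (Fin m) S),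
    pfaffian m (Matrix.of fun i j => d i * d j * A i j) = (∏ i, d i) * pfaffian m A
  | 0, d, A => by simp [pfaffian]
  | 1, d, A => by simp [pfaffian]
  | m + 2, d, A => by
    simp only [pfaffian]
    rw [Finset.mul_sum]
    refine Finset.sum_congr rfl fun j _ => ?_
    have := pfaffian_scale m (fun a => d (j.succAbove a).succ)
      (A.submatrix (fun a => (j.succAbove a).succ) (fun a => (j.succAbove a).succ))
    have e : ((Matrix.of fun i j => d i * d j * A i j).submatrix
        (fun a => (j.succAbove a).succ) (fun a => (j.succAbove a).succ))
        = Matrix.of fun i k => d (j.succAbove i).succ * d (j.succAbove k).succ *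
          A.submatrix (fun a => (j.succAbove a).succ) (fun a => (j.succAbove a).succ) i k := by
      ext; simp
    rw [e, this, Fin.prod_univ_succ, Fin.prod_univ_succAbove _ j, Matrix.of_apply]
    ring

theorem map_pfaffian {T : Type*} [CommRing T] (f : S →+* T) :
    ∀ (m : ℕ) (A : Matrix (Fin m) (Fin m) S), f (pfaffian m A) = pfaffian m (A.map f)
  | 0, A => by simp [pfaffian]
  | 1, A => by simp [pfaffian]
  | m + 2, A => by
    simp only [pfaffian, map_sum, map_mul, map_pow, map_neg, map_one, map_pfaffian f m,
      Matrix.map_apply, Matrix.submatrix_map]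

end Pfaffian

/-! Elementary symmetric polynomials and the sign change of the first variable. -/

section FirstVariable

variable {m : ℕ} {R : Type*} [CommRing R]

/-- The elementary symmetric polynomial `eᵢ(x₂, …, xₙ)`, with `n = m + 1`. -/
def esymmTail (m : ℕ) (R : Type*) [CommRing R] (i : ℕ) : MvPolynomial (Fin (m + 1)) R :=
  rename Fin.succ (esymm (Fin m) R i)

/-- The part `x₁ eᵢ₋₁(x₂, …, xₙ)` of `eᵢ` that is divisible by `x₁`. -/
def esymmHead (m : ℕ) (R : Type*) [CommRing R] : ℕ → MvPolynomial (Fin (m + 1)) R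
  | 0 => 0
  | i + 1 => X 0 * esymmTail m R i

theorem esymm_eq_head_add_tail (i : ℕ) :
    esymm (Fin (m + 1)) R i = esymmHead m R i + esymmTail m R i := by
  cases i with
  | zero => simp [esymmHead, esymmTail]
  | succ i =>
    have h : ∀ i, esymmTail m R i
        = (((Finset.univ : Finset (Fin m)).val.map Fin.succ).map
            (X : Fin (m + 1) → MvPolynomial (Fin (m + 1)) R)).esymm i := fun i => by
      rw [esymmTail, rename_eq_aeval, aeval_esymm_eq_multiset_esymm, Multiset.map_map]
    have hu : (Finset.univ : Finset (Fin (m + 1))).val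
        = 0 ::ₘ (Finset.univ : Finset (Fin m)).val.map Fin.succ := by
      rw [Fin.univ_succ]; rfl
    rw [esymmHead, h, h, esymm_eq_multiset_esymm, hu, Multiset.map_cons]
    simp only [Multiset.esymm, Multiset.powersetCard_cons, Multiset.map_add, Multiset.sum_add,
      Multiset.map_map, Function.comp_def, Multiset.prod_cons, Multiset.sum_map_mul_left]
    exact add_comm _ _

theorem esymmTail_eq_zero {i : ℕ} (hi : m < i) : esymmTail m R i = 0 := by
  rw [esymmTail, esymm, Finset.powersetCard_eq_empty.mpr (by simpa using hi)]
  simp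

theorem simpleReflection_zero_X :
    simpleReflection R (0 : Fin (m + 1)) (X 0) = -X 0 := by
  simp [simpleReflection]

theorem simpleReflection_zero_esymmTail (i : ℕ) :
    simpleReflection R (0 : Fin (m + 1)) (esymmTail m R i) = esymmTail m R i := by
  rw [simpleReflection, if_pos (by simp), esymmTail, aeval_rename, rename_eq_aeval]
  congr 1

theorem simpleReflection_zero_esymmHead (i : ℕ) :
    simpleReflection R (0 : Fin (m + 1)) (esymmHead m R i) = -esymmHead m R i := by
  cases i with
  | zero => simp [esymmHead]
  | succ i =>
    rw [esymmHead, map_mul, simpleReflection_zero_X, simpleReflection_zero_esymmTail, neg_mul]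

theorem simpleReflection_zero_esymm (i : ℕ) :
    simpleReflection R (0 : Fin (m + 1)) (esymm (Fin (m + 1)) R i)
      = esymmTail m R i - esymmHead m R i := by
  rw [esymm_eq_head_add_tail, map_add, simpleReflection_zero_esymmHead,
    simpleReflection_zero_esymmTail]
  ring

theorem sum_Icc_neg_one_pow_mul_add {A : Type*} [CommRing A] (c : ℕ → A) (j : ℕ) :
    ∑ p ∈ Finset.Icc 1 j, (-1) ^ p * (c (p - 1) + c p) = -c 0 + (-1) ^ j * c j := by
  induction j with
  | zero => simp
  | succ j ih =>
    rw [Finset.sum_Icc_succ_top (by omega), ih, Nat.add_sub_cancel]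
    ring

/-- Only the mixed head-tail products change sign. Moving the factor $x_1$ from one index to the
other gives $h_{i+p}t_{j-p}=t_{i+p-1}h_{j-p+1}$, so the alternating sum telescopes. -/
theorem simpleReflection_zero_qTildePair (i j : ℕ) :
    simpleReflection R (0 : Fin (m + 1)) (qTildePair (m + 1) R i j)
      = qTildePair (m + 1) R i j
        - 2 * (esymmHead m R i * esymm (Fin (m + 1)) R j
          - esymm (Fin (m + 1)) R i * esymmHead m R j) := by
  let c : ℕ → MvPolynomial (Fin (m + 1)) R :=
    fun p => esymmTail m R (i + p) * esymmHead m R (j - p)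
  have hc : ∀ p ∈ Finset.Icc 1 j,
      c (p - 1) = esymmHead m R (i + p) * esymmTail m R (j - p) := by
    intro p hp
    obtain ⟨h1, h2⟩ := Finset.mem_Icc.mp hp
    obtain ⟨q, rfl⟩ : ∃ q, p = q + 1 := ⟨p - 1, by omega⟩
    obtain ⟨r, rfl⟩ : ∃ r, j = q + 1 + r := ⟨j - (q + 1), by omega⟩
    have e1 : q + 1 + r - q = r + 1 := by omega
    have e2 : q + 1 + r - (q + 1) = r := by omega
    have e3 : esymmHead m R (i + (q + 1)) = X 0 * esymmTail m R (i + q) := rfl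
    have e4 : esymmHead m R (r + 1) = X 0 * esymmTail m R r := rfl
    simp only [c, Nat.add_sub_cancel, e1, e2, e3, e4]
    ring
  have hS := sum_Icc_neg_one_pow_mul_add c j
  -- The far end of the telescope vanishes because $h_0=0$.
  have h0 : c j = 0 := by simp [c, esymmHead]
  rw [h0, mul_zero, add_zero] at hS
  have hdiff : ∑ p ∈ Finset.Icc 1 j, (-1) ^ p *
        (esymm (Fin (m + 1)) R (i + p) * esymm (Fin (m + 1)) R (j - p))
      - ∑ p ∈ Finset.Icc 1 j, (-1) ^ p *
        ((esymmTail m R (i + p) - esymmHead m R (i + p))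
          * (esymmTail m R (j - p) - esymmHead m R (j - p)))
      = 2 * -c 0 := by
    rw [← hS, Finset.mul_sum, ← Finset.sum_sub_distrib]
    refine Finset.sum_congr rfl fun p hp => ?_
    rw [hc p hp, esymm_eq_head_add_tail, esymm_eq_head_add_tail]
    simp only [c]
    ring
  simp only [qTildePair, map_add, map_mul, map_sum, map_pow, map_neg, map_one, map_ofNat,
    simpleReflection_zero_esymm]
  have hc0 : c 0 = esymmTail m R i * esymmHead m R j := by simp [c]
  rw [hc0] at hdiff
  rw [sub_eq_iff_eq_add] at hdiff
  rw [hdiff, esymm_eq_head_add_tail i, esymm_eq_head_add_tail j]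
  ring

theorem qTildeMatrix_skew (n : ℕ) (L : List ℕ) (p q : Fin L.length) :
    qTildeMatrix n R L p q = -qTildeMatrix n R L q p := by
  rcases lt_trichotomy p q with h | h | h
  · simp [qTildeMatrix, h, h.not_gt]
  · subst h; simp [qTildeMatrix]
  · simp [qTildeMatrix, h, h.not_gt]

theorem qTildeMatrix_self (n : ℕ) (L : List ℕ) (p : Fin L.length) :
    qTildeMatrix n R L p p = 0 := by
  simp [qTildeMatrix]

/-- The sign change of `x₁` is a perturbation of rank two of the matrix `(Q̃_{i_p, i_q})`. -/
theorem map_simpleReflection_zero_qTildeMatrix (L : List ℕ) :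
    (qTildeMatrix (m + 1) R L).map (simpleReflection R (0 : Fin (m + 1)))
      = qTildeMatrix (m + 1) R L
        + wedgeMatrix (fun p => -2 * esymmHead m R (L.get p))
            (fun p => esymm (Fin (m + 1)) R (L.get p)) := by
  ext1 p q
  rw [Matrix.map_apply, Matrix.add_apply, wedgeMatrix, Matrix.of_apply]
  rcases lt_trichotomy p q with h | h | h
  · simp only [qTildeMatrix, if_pos h, simpleReflection_zero_qTildePair]
    ring
  · subst h
    simp only [qTildeMatrix_self, map_zero]
    ring
  · simp only [qTildeMatrix, if_pos h, if_neg h.not_gt, map_neg,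
      simpleReflection_zero_qTildePair]
    ring

theorem isSymmetric_qTildePair (n i j : ℕ) : (qTildePair n R i j).IsSymmetric := by
  intro s
  simp only [qTildePair, map_add, map_mul, map_sum, map_pow, map_neg, map_one, map_ofNat,
    rename_esymm]

theorem isSymmetric_qTildeMatrix (n : ℕ) (L : List ℕ) (p q : Fin L.length) :
    (qTildeMatrix n R L p q).IsSymmetric := by
  unfold qTildeMatrix
  split_ifs
  · exact isSymmetric_qTildePair _ _ _
  · exact (isSymmetric_qTildePair _ _ _).neg
  · exact IsSymmetric.zero

theorem isSymmetric_pfaffian {σ : Type*} {k : ℕ}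
    (A : Matrix (Fin k) (Fin k) (MvPolynomial σ R)) (hA : ∀ p q, (A p q).IsSymmetric) :
    (pfaffian k A).IsSymmetric := by
  intro s
  refine (map_pfaffian (rename s : MvPolynomial σ R →ₐ[R] MvPolynomial σ R).toRingHom k A).trans ?_
  congr 1
  ext1 p q
  exact hA p q s

end FirstVariable

/-! Divided differences and complete homogeneous symmetric polynomials. -/

section Complete

/-- The complete homogeneous symmetric polynomial of degree `d` in `y₀, …, y_{k-1}`. -/
def completeHom {A : Type*} [CommRing A] (y : ℕ → A) : ℕ → ℕ → A
  | 0, 0 => 1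
  | 0, _ + 1 => 0
  | _ + 1, 0 => 1
  | k + 1, d + 1 => completeHom y k (d + 1) + y k * completeHom y (k + 1) d

variable {A : Type*} [CommRing A]

theorem completeHom_zero_right (y : ℕ → A) (k : ℕ) : completeHom y k 0 = 1 := by
  cases k <;> simp [completeHom]

theorem completeHom_one (y : ℕ → A) (d : ℕ) : completeHom y 1 d = y 0 ^ d := by
  induction d with
  | zero => simp [completeHom]
  | succ d ih => rw [completeHom, ih, completeHom, pow_succ]; ring

theorem map_completeHom {B : Type*} [CommRing B] (f : A →+* B) (y : ℕ → A) (k d : ℕ) :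
    f (completeHom y k d) = completeHom (fun j => f (y j)) k d := by
  induction k generalizing d with
  | zero => cases d <;> simp [completeHom]
  | succ k ihk =>
    induction d with
    | zero => simp [completeHom]
    | succ d ihd => simp only [completeHom, map_add, map_mul, ihk, ihd]

theorem completeHom_congr {y z : ℕ → A} {k : ℕ} (h : ∀ j < k, y j = z j) (d : ℕ) :
    completeHom y k d = completeHom z k d := by
  induction k generalizing d with
  | zero => cases d <;> simp [completeHom]
  | succ k ihk =>
    induction d with
    | zero => simp [completeHom]
    | succ d ihd =>
      simp only [completeHom, ihk fun j hj => h j (by omega), ihd, h k (by omega)]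

/-- With `z` obtained from `y` by exchanging entries `k` and `k + 1`, this is a divided difference:
the degree drops by one and a variable is gained. -/
theorem completeHom_sub_completeHom {y z : ℕ → A} {k : ℕ} (h : ∀ j < k, z j = y j)
    (hk : z k = y (k + 1)) (d : ℕ) :
    completeHom y (k + 1) (d + 1) - completeHom z (k + 1) (d + 1)
      = (y k - y (k + 1)) * completeHom y (k + 2) d := by
  induction d with
  | zero =>
    simp only [completeHom, completeHom_congr h, hk]
    ring
  | succ d ih =>
    have e1 : completeHom y (k + 1) (d + 1 + 1)
        = completeHom y k (d + 2) + y k * completeHom y (k + 1) (d + 1) := by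
      rw [completeHom]
    have e2 : completeHom z (k + 1) (d + 1 + 1)
        = completeHom y k (d + 2) + y (k + 1) * completeHom z (k + 1) (d + 1) := by
      rw [completeHom, completeHom_congr h, hk]
    have e3 : completeHom y (k + 2) (d + 1)
        = completeHom y (k + 1) (d + 1) + y (k + 1) * completeHom y (k + 2) d := by
      rw [completeHom]
    rw [e1, e2, e3]
    linear_combination y (k + 1) * ih

end Complete

/-! ### The type A chain: linearity over symmetric polynomials and values on powers of $x_1$. -/

section Chain

variable {n m : ℕ} {R : Type*} [CommRing R]

theorem simpleReflection_succ (i : Fin m) :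
    simpleReflection R i.succ = rename (Equiv.swap i.castSucc i.succ) := by
  rw [simpleReflection, if_neg (by simp)]
  rfl

theorem simpleDenom_succ (i : Fin m) :
    simpleDenom R i.succ = X i.castSucc - X i.succ := by
  rw [simpleDenom, if_neg (by simp)]
  rfl

/-- The composite `f ↦ f ∂₁ ⋯ ∂ₘ` of the divided differences of type A. -/
def symChain (f : MvPolynomial (Fin (m + 1)) R) : MvPolynomial (Fin (m + 1)) R :=
  (List.finRange m).foldl (fun g i => divDiff i.succ g) f

theorem divDiffChain_eq (f : MvPolynomial (Fin (m + 1)) R) :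
    divDiffChain f = symChain (divDiff 0 f) := by
  rw [divDiffChain, symChain, List.finRange_succ, List.foldl_cons, List.foldl_map]

variable [IsDomain R]

theorem divDiff_add (i : Fin n) (f g : MvPolynomial (Fin n) R) :
    divDiff i (f + g) = divDiff i f + divDiff i g := by
  refine divDiff_unique i _ _ ?_
  rw [map_add, mul_add, ← divDiff_spec, ← divDiff_spec]
  ring

theorem divDiff_mul {i : Fin n} {c : MvPolynomial (Fin n) R}
    (hc : simpleReflection R i c = c) (f : MvPolynomial (Fin n) R) :
    divDiff i (c * f) = c * divDiff i f := by
  refine divDiff_unique i _ _ ?_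
  rw [map_mul, hc, mul_left_comm, ← divDiff_spec]
  ring

theorem symChain_add (f g : MvPolynomial (Fin (m + 1)) R) :
    symChain (f + g) = symChain f + symChain g := by
  unfold symChain
  generalize List.finRange m = l
  induction l generalizing f g with
  | nil => rfl
  | cons i l ih => rw [List.foldl_cons, divDiff_add, ih]; rfl

theorem symChain_mul {c : MvPolynomial (Fin (m + 1)) R} (hc : c.IsSymmetric)
    (f : MvPolynomial (Fin (m + 1)) R) : symChain (c * f) = c * symChain f := by
  unfold symChain
  generalize List.finRange m = l
  induction l generalizing f with
  | nil => rfl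
  | cons i l ih =>
    rw [List.foldl_cons, divDiff_mul, ih]
    · rfl
    · rw [simpleReflection_succ]; exact hc _

theorem symChain_zero : symChain (0 : MvPolynomial (Fin (m + 1)) R) = 0 := by
  simpa using symChain_mul (IsSymmetric.zero : (0 : MvPolynomial (Fin (m + 1)) R).IsSymmetric) 0

theorem symChain_sub (f g : MvPolynomial (Fin (m + 1)) R) :
    symChain (f - g) = symChain f - symChain g := by
  rw [eq_sub_iff_add_eq, ← symChain_add, sub_add_cancel]

theorem symChain_sum {ι : Type*} (s : Finset ι) (f : ι → MvPolynomial (Fin (m + 1)) R) :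
    symChain (∑ i ∈ s, f i) = ∑ i ∈ s, symChain (f i) :=
  map_sum (⟨⟨symChain, symChain_zero⟩, symChain_add⟩ :
    MvPolynomial (Fin (m + 1)) R →+ MvPolynomial (Fin (m + 1)) R) f s

theorem foldl_finRange_eq {α : Type*} (m : ℕ) (F : Fin m → α → α) (G : ℕ → α)
    (h : ∀ i : Fin m, F i (G i) = G (i + 1)) :
    (List.finRange m).foldl (fun g i => F i g) (G 0) = G m := by
  induction m with
  | zero => rfl
  | succ m ih =>
    rw [List.finRange_succ_last, List.foldl_append, List.foldl_map,
      ih (fun i => F i.castSucc) fun i => h i.castSucc]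
    exact h (Fin.last m)

/-- The variables as a sequence. -/
def varSeq (n : ℕ) (R : Type*) [CommRing R] (j : ℕ) : MvPolynomial (Fin n) R :=
  if h : j < n then X ⟨j, h⟩ else 0

theorem divDiff_completeHom (i : Fin m) (d : ℕ) :
    divDiff i.succ (completeHom (varSeq (m + 1) R) (i + 1) (d + 1))
      = completeHom (varSeq (m + 1) R) (i + 2) d := by
  refine divDiff_unique _ _ _ ?_
  have hi := i.isLt
  have h1 : varSeq (m + 1) R i = X i.castSucc := by
    rw [varSeq, dif_pos (by omega)]; rfl
  have h2 : varSeq (m + 1) R (i + 1) = X i.succ := by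
    rw [varSeq, dif_pos (by omega)]; rfl
  rw [simpleDenom_succ, ← h1, ← h2, simpleReflection_succ]
  refine (congrArg _ (map_completeHom (rename (Equiv.swap i.castSucc i.succ) :
    MvPolynomial (Fin (m + 1)) R →ₐ[R] MvPolynomial (Fin (m + 1)) R).toRingHom _ _ _)).trans ?_
  refine completeHom_sub_completeHom (fun j hj => ?_) ?_ d
  · change rename _ (varSeq (m + 1) R j) = varSeq (m + 1) R j
    rw [varSeq, dif_pos (by omega), rename_X, Equiv.swap_apply_of_ne_of_ne]
    · simp [Fin.ext_iff]; omega
    · simp [Fin.ext_iff]; omega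
  · change rename _ (varSeq (m + 1) R i) = _
    rw [h1, h2, rename_X, Equiv.swap_apply_left]

theorem divDiff_of_invariant {i : Fin n} {f : MvPolynomial (Fin n) R}
    (hf : simpleReflection R i f = f) : divDiff i f = 0 :=
  divDiff_unique i _ _ (by rw [hf]; ring)

theorem symChain_X_zero_pow (N : ℕ) :
    symChain (X 0 ^ N : MvPolynomial (Fin (m + 1)) R)
      = if m ≤ N then completeHom (varSeq (m + 1) R) (m + 1) (N - m) else 0 := by
  have h := foldl_finRange_eq m (fun i g => divDiff i.succ g)
    (fun j => if j ≤ N then completeHom (varSeq (m + 1) R) (j + 1) (N - j) else 0) ?_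
  · rw [symChain]
    simpa [completeHom_one, varSeq] using h
  · intro i
    rcases lt_trichotomy (i : ℕ) N with hi | hi | hi
    · obtain ⟨d, rfl⟩ : ∃ d, N = i + 1 + d := ⟨N - (i + 1), by omega⟩
      have e1 : (i : ℕ) + 1 + d - i = d + 1 := by omega
      have e2 : (i : ℕ) + 1 + d - (i + 1) = d := by omega
      simp only [if_pos hi.le, if_pos (Nat.succ_le_of_lt hi), e1, e2]
      exact divDiff_completeHom i d
    -- At `i = N` the degree has dropped to 0, and the constant 1 is killed.
    · simp only [hi, le_refl, if_true, Nat.sub_self, completeHom_zero_right]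
      rw [if_neg (by omega)]
      exact divDiff_of_invariant (map_one _)
    · simp only [if_neg hi.not_ge]
      rw [if_neg (by omega)]
      exact divDiff_of_invariant (map_zero _)

theorem symChain_X_zero_pow_self : symChain (X 0 ^ m : MvPolynomial (Fin (m + 1)) R) = 1 := by
  rw [symChain_X_zero_pow, if_pos le_rfl, Nat.sub_self, completeHom_zero_right]

end Chain

/-! ### Images of heads, tails and reflected Pfaffians under the chain. -/

section Main

variable {m : ℕ} {R : Type*} [CommRing R] [IsDomain R]

/-- Since $x_1t_i=e_{i+1}-t_{i+1}$, a factor $x_1$ is traded for a higher index until $t_i=0$. The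
symmetric terms split off carry $x_1^j$ with $j<m$, which the chain kills. -/
theorem symChain_X_zero_pow_mul_esymmTail {j : ℕ} (hj : j ≤ m) : ∀ i, m < i + j →
    symChain (X 0 ^ j * esymmTail m R i) = 0 := by
  induction j with
  | zero =>
    intro i hi
    rw [esymmTail_eq_zero (by omega), mul_zero, symChain_zero]
  | succ j ih =>
    intro i hi
    have h : X 0 ^ (j + 1) * esymmTail m R i
        = esymm (Fin (m + 1)) R (i + 1) * X 0 ^ j - X 0 ^ j * esymmTail m R (i + 1) := by
      rw [esymm_eq_head_add_tail, esymmHead]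
      ring
    rw [h, symChain_sub, symChain_mul (esymm_isSymmetric _ _ _), ih (by omega) _ (by omega),
      symChain_X_zero_pow, if_neg (by omega)]
    ring

theorem symChain_X_zero_pow_mul_esymmHead (i : ℕ) :
    symChain (X 0 ^ m * esymmHead m R i)
      = if i = 0 then 0 else esymm (Fin (m + 1)) R i := by
  split_ifs with h
  · subst h
    rw [esymmHead, mul_zero, symChain_zero]
  · have e : X 0 ^ m * esymmHead m R i
        = esymm (Fin (m + 1)) R i * X 0 ^ m - X 0 ^ m * esymmTail m R i := by
      rw [esymm_eq_head_add_tail]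
      ring
    rw [e, symChain_sub, symChain_mul (esymm_isSymmetric _ _ _),
      symChain_X_zero_pow_mul_esymmTail le_rfl i (by omega), symChain_X_zero_pow_self]
    ring

/-- The type A divided differences replace, in the affine expression of the reflected Pfaffian,
the polynomials `esymmHead` by their images. -/
theorem symChain_X_zero_pow_mul_pfaffian (L : List ℕ) :
    symChain (X 0 ^ m * simpleReflection R (0 : Fin (m + 1))
        (pfaffian L.length (qTildeMatrix (m + 1) R L)))
      = pfaffian L.length (qTildeMatrix (m + 1) R L
        + wedgeMatrix
            (fun p => -2 * if L.get p = 0 then 0 else esymm (Fin (m + 1)) R (L.get p))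
            (fun p => esymm (Fin (m + 1)) R (L.get p))) := by
  obtain ⟨φ, hφ⟩ := exists_pfaffian_add_wedgeMatrix (qTildeMatrix (m + 1) R L)
    (qTildeMatrix_skew _ L) (qTildeMatrix_self _ L)
    (fun p => esymm (Fin (m + 1)) R (L.get p))
  have hP : (pfaffian L.length (qTildeMatrix (m + 1) R L)).IsSymmetric :=
    isSymmetric_pfaffian _ (isSymmetric_qTildeMatrix _ L)
  -- Each coefficient of `φ` is a difference of two Pfaffians with symmetric entries.
  have hs : ∀ p, (φ (Pi.single p 1)).IsSymmetric := by
    intro p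
    have h : φ (Pi.single p 1) = _ - _ := eq_sub_of_add_eq' (hφ (Pi.single p 1)).symm
    rw [h]
    refine IsSymmetric.sub (isSymmetric_pfaffian _ fun q r => ?_) hP
    have h1 : ∀ q, (Pi.single p 1 : Fin L.length → MvPolynomial (Fin (m + 1)) R) q
        |>.IsSymmetric := fun q => by
      rcases eq_or_ne q p with rfl | hq
      · rw [Pi.single_eq_same]; exact IsSymmetric.one
      · rw [Pi.single_eq_of_ne hq]; exact IsSymmetric.zero
    exact (isSymmetric_qTildeMatrix _ L q r).add
      (((h1 q).mul (esymm_isSymmetric _ _ _)).sub ((esymm_isSymmetric _ _ _).mul (h1 r)))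
  have hφs : ∀ a, φ a = ∑ p, φ (Pi.single p 1) * a p := fun a => by
    rw [LinearMap.pi_apply_eq_sum_univ φ a]
    refine Finset.sum_congr rfl fun p _ => ?_
    rw [smul_eq_mul, mul_comm]
    congr 2
    ext1 q
    simp [Pi.single_apply, eq_comm]
  have hmap := map_pfaffian (simpleReflection R (0 : Fin (m + 1))).toRingHom L.length
    (qTildeMatrix (m + 1) R L)
  have hmat := map_simpleReflection_zero_qTildeMatrix (m := m) (R := R) L
  have h2 : simpleReflection R (0 : Fin (m + 1))
      (pfaffian L.length (qTildeMatrix (m + 1) R L)) = _ :=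
    hmap.trans ((congrArg (pfaffian L.length) hmat).trans (hφ _))
  rw [h2, hφ, hφs, hφs, mul_add, symChain_add, mul_comm (X 0 ^ m), symChain_mul hP,
    symChain_X_zero_pow_self, mul_one, Finset.mul_sum, symChain_sum]
  congr 1
  refine Finset.sum_congr rfl fun p _ => ?_
  have hc : (φ (Pi.single p 1) * (-2)).IsSymmetric :=
    (hs p).mul fun s => by rw [map_neg, map_ofNat]
  rw [← symChain_X_zero_pow_mul_esymmHead, ← mul_assoc (φ (Pi.single p 1)) (-2) (symChain _),
    ← symChain_mul hc]
  congr 1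
  ring

theorem symChain_X_zero_pow_mul_qTilde {I : List ℕ} (hI : ∀ i ∈ I, 0 < i) :
    symChain (X 0 ^ m * simpleReflection R (0 : Fin (m + 1)) (qTilde (m + 1) R I))
      = (-1) ^ I.length * qTilde (m + 1) R I := by
  rw [qTilde, symChain_X_zero_pow_mul_pfaffian]
  by_cases h : Even I.length
  · rw [show evenRepresentative I = I from if_pos h, h.neg_one_pow, one_mul]
    congr 1
    ext1 p q
    have h0 : ∀ p : Fin I.length, I.get p ≠ 0 := fun p => (hI _ (I.get_mem p)).ne'
    -- All parts are nonzero, so the two vectors of the wedge are proportional.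
    simp only [Matrix.add_apply, wedgeMatrix, Matrix.of_apply, if_neg (h0 _)]
    ring
  · rw [show evenRepresentative I = I ++ [0] from if_neg h]
    let l : Fin (I ++ [0]).length := ⟨I.length, by simp⟩
    have hl : (I ++ [0]).get l = 0 := by simp [l]
    have hne : ∀ p, p ≠ l → p < l ∧ (I ++ [0]).get p ≠ 0 := fun p hp => by
      have h1 : (p : ℕ) ≠ I.length := fun h => hp (Fin.ext h)
      have h2 : (p : ℕ) < I.length := by
        have h3 : (p : ℕ) < I.length + 1 := p.isLt.trans_eq (by simp)
        omega
      refine ⟨h2, ?_⟩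
      rw [List.get_eq_getElem, List.getElem_append_left h2]
      exact (hI _ (List.getElem_mem h2)).ne'
    -- Against the appended zero the entry $e_{i_p}$ becomes $e_{i_p}-2e_{i_p}=-e_{i_p}$, while all
    -- other entries are unchanged: a rescaling of the last row and column by $-1$.
    let d : Fin (I ++ [0]).length → MvPolynomial (Fin (m + 1)) R :=
      fun p => if p = l then -1 else 1
    have hd : ∏ p, d p = (-1) ^ I.length := by
      rw [(Nat.not_even_iff_odd.mp h).neg_one_pow, Finset.prod_ite_eq' Finset.univ l]
      simp
    rw [← hd, ← pfaffian_scale]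
    congr 1
    ext1 p q
    simp only [Matrix.add_apply, wedgeMatrix, Matrix.of_apply, d]
    have hQ : ∀ p, p ≠ l → qTildeMatrix (m + 1) R (I ++ [0]) p l
        = esymm (Fin (m + 1)) R ((I ++ [0]).get p) := fun p hp => by
      rw [qTildeMatrix, if_pos (hne p hp).1, hl, qTildePair]
      simp
    by_cases hp : p = l <;> by_cases hq : q = l
    · rw [hp, hq, qTildeMatrix_self]
      ring
    · rw [hp, qTildeMatrix_skew, hQ q hq, if_pos hl, if_neg (hne q hq).2, hl, if_pos rfl,
        if_neg hq, esymm_zero]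
      ring
    · rw [hq, hQ p hp, if_pos hl, if_neg (hne p hp).2, hl, if_pos rfl, if_neg hp, esymm_zero]
      ring
    · rw [if_neg (hne p hp).2, if_neg (hne q hq).2, if_neg hp, if_neg hq]
      ring

theorem divDiff_zero_mul_pow (f : MvPolynomial (Fin (m + 1)) R) :
    divDiff 0 (f * X 0 ^ (m + 1))
      = -(X 0 ^ m * f) + (-1) ^ (m + 1) * (X 0 ^ m * simpleReflection R 0 f) := by
  refine divDiff_unique _ _ _ ?_
  rw [map_mul, map_pow, simpleReflection_zero_X, simpleDenom, if_pos (by simp), neg_pow]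
  ring

theorem divDiffChain_qTilde_mul_pow {I : List ℕ} (hI : ∀ i ∈ I, 0 < i) :
    divDiffChain (qTilde (m + 1) R I * X 0 ^ (m + 1))
      = if Odd (m + 1 + I.length) then -2 * qTilde (m + 1) R I else 0 := by
  have hP : (qTilde (m + 1) R I).IsSymmetric :=
    isSymmetric_pfaffian _ (isSymmetric_qTildeMatrix _ _)
  have hsign : ((-1) ^ (m + 1) : MvPolynomial (Fin (m + 1)) R).IsSymmetric := by
    intro s
    simp
  have hX : -(X 0 ^ m * qTilde (m + 1) R I) = (-qTilde (m + 1) R I) * X 0 ^ m := by ring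
  rw [divDiffChain_eq, divDiff_zero_mul_pow, hX, symChain_add, symChain_mul hP.neg,
    symChain_mul hsign, symChain_X_zero_pow_mul_qTilde hI, symChain_X_zero_pow_self,
    ← mul_assoc, ← pow_add]
  split_ifs with h
  · rw [h.neg_one_pow]
    ring
  · rw [(Nat.not_odd_iff_even.mp h).neg_one_pow]
    ring

end Main

instance : IsDomain ZHalf :=
  IsLocalization.isDomain_localization
    (powers_le_nonZeroDivisors_of_noZeroDivisors (two_ne_zero : (2 : ℤ) ≠ 0))

end

theorem proposition28 (n : ℕ) (hn : 0 < n) (I : List ℕ) (hI : IsStrictPartition I)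
    (hIn : PartitionLE I (staircase n)) :
    divDiffChain (qTilde n ZHalf I * X (⟨0, hn⟩ : Fin n) ^ n)
      = if Odd (n + I.length) then -2 * qTilde n ZHalf I else 0 := by
  obtain ⟨m, rfl⟩ : ∃ m, n = m + 1 := ⟨n - 1, by omega⟩
  exact divDiffChain_qTilde_mul_pow hI.2
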